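/- Let $L=\{0,1,+,\cdot,<\}$ and let $\mathrm{PA}$ be the $L$-theory consisting of the axioms of discretely ordered semirings together with the induction scheme for all $L$-formulas (with parameters). Let $\mathcal M$ be a countable model of $\mathrm{PA}$, and call $\mathcal M$ homogeneous if every partial elementary map from $\mathcal M$ to $\mathcal M$ with finite domain extends to an automorphism of $\mathcal M$. The $\Sigma^{\mathrm{in}}_\alpha$ and $\Pi^{\mathrm{in}}_\alpha$ formulas of $L_{\omega_1\omega}$ are defined as follows: for $\alpha=0$ both are the finitary quantifier-free formulas; for $\alpha>0$ a $\Sigma^{\mathrm{in}}_\alpha$ formula is a countable disjunction $\bigvee_i\exists\bar y_i\,\psi_i(\bar x,\bar y_i)$ in which each $\psi_i$ is $\Pi^{\mathrm{in}}_{\beta_i}$ for some $\beta_i<\alpha$, and a $\Pi^{\mathrm{in}}_\alpha$ formula is a countable conjunction $\bigwedge_i\forall\bar y_i\,\psi_i(\bar x,\bar y_i)$ in which each $\psi_i$ is $\Sigma^{\mathrm{in}}_{\beta_i}$ for some $\beta_i<\alpha$. The Scott rank $SR(\mathcal M)$ is the least ordinal $\alpha$ such that for every finite tuple $\bar a$ of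 $\mathcal M$ the automorphism orbit of $\bar a$ is defined in $\mathcal M$ by a $\Sigma^{\mathrm{in}}_\alpha$ formula without parameters. If $\mathcal M$ is not homogeneous, then $SR(\mathcal M)>\omega$. -/

import Mathlib

open FirstOrder FirstOrder.Language

universe u v w

/-! ### Peano arithmetic -/

/-- The function symbols `0`, `1`, `+`, `·` of arithmetic. -/
inductive ArithFunc : ℕ → Type
  | zero : ArithFunc 0
  | one : ArithFunc 0
  | add : ArithFunc 2
  | mul : ArithFunc 2

/-- The relation symbol `<` of arithmetic. -/
inductive ArithRel : ℕ → Type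
  | lt : ArithRel 2

/-- The first-order language `{0, 1, +, ·, <}` of arithmetic. -/
def arith : FirstOrder.Language.{0, 0} where
  Functions := ArithFunc
  Relations := ArithRel

namespace arith

instance instZeroTerm (α : Type w) : Zero (arith.Term α) where
  zero := Constants.term (L := arith) ArithFunc.zero

instance instOneTerm (α : Type w) : One (arith.Term α) where
  one := Constants.term (L := arith) ArithFunc.one

instance instAddTerm (α : Type w) : Add (arith.Term α) where
  add := Functions.apply₂ (L := arith) ArithFunc.add

instance instMulTerm (α : Type w) : Mul (arith.Term α) where
  mul := Functions.apply₂ (L := arith) ArithFunc.mul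

/-- The atomic formula `s < t`. -/
def lt {α : Type w} {n : ℕ} (s t : arith.Term (α ⊕ Fin n)) : arith.BoundedFormula α n :=
  Relations.boundedFormula₂ (L := arith) ArithRel.lt s t

/-- The sentence `∀ x, f(x)`. -/
def all₁ (f : arith.Term (Empty ⊕ Fin 1) → arith.BoundedFormula Empty 1) : arith.Sentence :=
  ∀' f (&0)

/-- The sentence `∀ x y, f(x, y)`. -/
def all₂ (f : arith.Term (Empty ⊕ Fin 2) → arith.Term (Empty ⊕ Fin 2) →
    arith.BoundedFormula Empty 2) : arith.Sentence :=
  ∀' ∀' f (&0) (&1)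

/-- The sentence `∀ x y z, f(x, y, z)`. -/
def all₃ (f : arith.Term (Empty ⊕ Fin 3) → arith.Term (Empty ⊕ Fin 3) →
    arith.Term (Empty ⊕ Fin 3) → arith.BoundedFormula Empty 3) : arith.Sentence :=
  ∀' ∀' ∀' f (&0) (&1) (&2)

/-- The axioms of discretely ordered semirings. -/
def discreteOrderedSemiring : arith.Theory :=
  { -- addition and multiplication
    all₃ fun x y z => ((x + y) + z) =' (x + (y + z)),
    all₂ fun x y => (x + y) =' (y + x),
    all₃ fun x y z => ((x * y) * z) =' (x * (y * z)),
    all₂ fun x y => (x * y) =' (y * x),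
    all₃ fun x y z => (x * (y + z)) =' (x * y + x * z),
    all₁ fun x => (x + 0) =' x,
    all₁ fun x => (x * 0) =' 0,
    all₁ fun x => (x * 1) =' x,
    -- the strict linear order
    all₃ fun x y z => lt x y ⟹ lt y z ⟹ lt x z,
    all₁ fun x => ∼(lt x x),
    all₂ fun x y => lt x y ⊔ (x =' y) ⊔ lt y x,
    -- compatibility of the order with the operations
    all₃ fun x y z => lt x y ⟹ lt (x + z) (y + z),
    all₃ fun x y z => lt 0 z ⟹ lt x y ⟹ lt (x * z) (y * z),
    -- `∀ x y, x < y → ∃ z, x + z = y`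
    all₂ fun x y => lt x y ⟹
      ∃' (((&0 : arith.Term (Empty ⊕ Fin 3)) + &2) =' &1),
    -- discreteness, and `0` is the least element
    lt 0 1,
    all₁ fun x => lt 0 x ⟹ lt 1 x ⊔ (1 =' x),
    all₁ fun x => lt 0 x ⊔ (0 =' x) }

/-- The induction axiom for the formula `φ(ȳ, x)`, with parameters `ȳ = (y₀, …, yₙ₋₁)`:
`∀ ȳ (φ(ȳ, 0) → ∀ x (φ(ȳ, x) → φ(ȳ, x + 1)) → ∀ x φ(ȳ, x))`. -/
noncomputable def inductionAxiom {n : ℕ} (φ : arith.Formula (Fin n ⊕ Unit)) : arith.Sentence :=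
  let base : arith.Formula (Fin n) :=
    φ.subst (Sum.elim Term.var (fun _ => 0))
  let step : arith.Formula (Fin n) :=
    Formula.iAlls Unit (φ.imp
      (φ.subst (Sum.elim (fun i => Term.var (Sum.inl i)) (fun u => Term.var (Sum.inr u) + 1))))
  let concl : arith.Formula (Fin n) := Formula.iAlls Unit φ
  Formula.iAlls (Fin n) ((base.imp (step.imp concl)).relabel Sum.inr)

/-- Peano arithmetic: the axioms of discretely ordered semirings and the induction scheme. -/
def PA : arith.Theory :=
  discreteOrderedSemiring ∪ {σ | ∃ (n : ℕ) (φ : arith.Formula (Fin n ⊕ Unit)), σ = inductionAxiom φ}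

end arith

/-! ### Homogeneous structures -/

/-- A (countable) structure is homogeneous if every finite partial elementary map from it to
itself extends to an automorphism. -/
def IsHomogeneous (L : FirstOrder.Language.{u, v}) (M : Type w) [L.Structure M] : Prop :=
  ∀ (s : Set M) (f : s → M), s.Finite →
    (∀ φ : L.Formula s, φ.Realize (fun x : s => (x : M)) ↔ φ.Realize f) →
    ∃ σ : M ≃[L] M, ∀ x : s, σ x = f x

/-! ### Infinitary formulas and Scott rank -/

/-- Formulas of `L_{ω₁ω}` in normal form in the free variables `x₀, …, xₙ₋₁`: finitary
quantifier-free formulas, countable disjunctions `⋁ᵢ ∃ ȳᵢ ψᵢ(x̄, ȳᵢ)` and countable conjunctions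
`⋀ᵢ ∀ ȳᵢ ψᵢ(x̄, ȳᵢ)`, where `ȳᵢ` is a tuple of `k i` variables. -/
inductive InfFormula (L : FirstOrder.Language.{u, v}) : ℕ → Type (max u v)
  | qf {n : ℕ} (φ : L.Formula (Fin n)) (hφ : BoundedFormula.IsQF φ) : InfFormula L n
  | disjEx {n : ℕ} (k : ℕ → ℕ) (ψ : ∀ i, InfFormula L (n + k i)) : InfFormula L n
  | conjAll {n : ℕ} (k : ℕ → ℕ) (ψ : ∀ i, InfFormula L (n + k i)) : InfFormula L n

namespace InfFormula

/-- Satisfaction of an infinitary formula by a tuple. -/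
def Realize {L : FirstOrder.Language.{u, v}} {M : Type w} [L.Structure M] :
    ∀ {n : ℕ}, InfFormula L n → (Fin n → M) → Prop
  | _, qf φ _, a => φ.Realize a
  | _, disjEx k ψ, a => ∃ i, ∃ c : Fin (k i) → M, (ψ i).Realize (Fin.append a c)
  | _, conjAll k ψ, a => ∀ i, ∀ c : Fin (k i) → M, (ψ i).Realize (Fin.append a c)

mutual

/-- `Σ^in_α` formulas: for `α = 0` the finitary quantifier-free formulas, and for `α > 0` the
countable disjunctions `⋁ᵢ ∃ ȳᵢ ψᵢ` with every `ψᵢ` in `Π^in_β` for some `β < α`. -/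
inductive IsSigma {L : FirstOrder.Language.{u, v}} : Ordinal.{0} → ∀ {n : ℕ}, InfFormula L n → Prop
  | qf {n : ℕ} (φ : L.Formula (Fin n)) (hφ : BoundedFormula.IsQF φ) : IsSigma 0 (qf φ hφ)
  | disjEx {α : Ordinal.{0}} {n : ℕ} (k : ℕ → ℕ) (ψ : ∀ i, InfFormula L (n + k i))
      (β : ℕ → Ordinal.{0}) (hβ : ∀ i, β i < α) (hψ : ∀ i, IsPi (β i) (ψ i)) :
      IsSigma α (disjEx k ψ)

/-- `Π^in_α` formulas: for `α = 0` the finitary quantifier-free formulas, and for `α > 0` the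
countable conjunctions `⋀ᵢ ∀ ȳᵢ ψᵢ` with every `ψᵢ` in `Σ^in_β` for some `β < α`. -/
inductive IsPi {L : FirstOrder.Language.{u, v}} : Ordinal.{0} → ∀ {n : ℕ}, InfFormula L n → Prop
  | qf {n : ℕ} (φ : L.Formula (Fin n)) (hφ : BoundedFormula.IsQF φ) : IsPi 0 (qf φ hφ)
  | conjAll {α : Ordinal.{0}} {n : ℕ} (k : ℕ → ℕ) (ψ : ∀ i, InfFormula L (n + k i))
      (β : ℕ → Ordinal.{0}) (hβ : ∀ i, β i < α) (hψ : ∀ i, IsSigma (β i) (ψ i)) :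
      IsPi α (conjAll k ψ)

end

end InfFormula

/-- Every automorphism orbit of a finite tuple of `M` is definable by a `Σ^in_α` formula without
parameters. -/
def OrbitsSigmaDefinable (L : FirstOrder.Language.{u, v}) (M : Type w) [L.Structure M]
    (α : Ordinal.{0}) : Prop :=
  ∀ (n : ℕ) (a : Fin n → M), ∃ φ : InfFormula L n, φ.IsSigma α ∧
    ∀ b : Fin n → M, φ.Realize b ↔ ∃ σ : M ≃[L] M, ∀ i, σ (a i) = b i

/-- The (parameterless) Scott rank: the least ordinal `α` such that every automorphism orbit is
`Σ^in_α`-definable without parameters. (Such an `α` exists for every countable structure in a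
countable language; the value `⊤` would stand for the absence of such an `α`.) -/
noncomputable def scottRank (L : FirstOrder.Language.{u, v}) (M : Type w) [L.Structure M] :
    WithTop Ordinal.{0} :=
  sInf ((fun α : Ordinal.{0} => (α : WithTop Ordinal.{0})) '' {α | OrbitsSigmaDefinable L M α})

-- Suppose every orbit is defined by a formula of rank at most `ω`. If `M` has only standard
-- elements, each element is definable and the identity extends every partial elementary map. If `M`
-- is nonstandard, the point is that a tuple `b` with the same complete type as `a` satisfies every
-- `Σ^in_ω` formula true of `a` (`realize_of_isSigma_of_le_omega0`). Applied to the formula defining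
-- the orbit of `a`, this puts `b` in that orbit.
--
-- Tuples are coded by single elements, so back-and-forth positions are pairs of elements. For each
-- standard `k`, the `k`-round game whose final position is tested only up to depth `N` is a
-- definable relation of `N` and the position, because the test can be phrased with a coded finite
-- relation (`isDef_game`). For standard `N` the test involves finitely many functions, so equality
-- of a definable invariant with finitely many values suffices for survival; positions of equal type
-- therefore survive (`exists_game_invariant`). Overspill then yields a nonstandard `N` for which
-- the second player still survives (`exists_nonstandard_game`). Nonstandard depth exceeds every
-- standard depth, so final positions agree on all quantifier-free formulas, and `k` rounds transfer
-- all infinitary formulas of rank at most `k` (`Game.realize_iff`). A `Σ^in_ω` formula needs only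
-- one disjunct, of finite rank, to be transferred.

namespace arith

/-! ### Definable relations and functions -/

section Definable

variable {M : Type w} [arith.Structure M] {α β : Type}

/-- A relation between the values of the variables in `α` is definable without parameters. -/
def IsDef (P : (α → M) → Prop) : Prop :=
  ∃ φ : arith.Formula α, ∀ v, φ.Realize v ↔ P v

/-- A function of the variables in `α` has a graph that is definable without parameters. -/
def IsDefFun (f : (α → M) → M) : Prop :=
  IsDef fun w : α ⊕ Unit → M => f (fun a => w (.inl a)) = w (.inr ())

namespace IsDef

theorem congr {P Q : (α → M) → Prop} (hP : IsDef P) (h : ∀ v, P v ↔ Q v) : IsDef Q := by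
  obtain ⟨φ, hφ⟩ := hP
  exact ⟨φ, fun v => (hφ v).trans (h v)⟩

theorem not {P : (α → M) → Prop} (hP : IsDef P) : IsDef fun v => ¬ P v := by
  obtain ⟨φ, hφ⟩ := hP
  exact ⟨φ.not, fun v => by simp [hφ]⟩

theorem imp {P Q : (α → M) → Prop} (hP : IsDef P) (hQ : IsDef Q) : IsDef fun v => P v → Q v := by
  obtain ⟨φ, hφ⟩ := hP
  obtain ⟨ψ, hψ⟩ := hQ
  exact ⟨φ.imp ψ, fun v => by simp [hφ, hψ]⟩

theorem and {P Q : (α → M) → Prop} (hP : IsDef P) (hQ : IsDef Q) : IsDef fun v => P v ∧ Q v := by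
  obtain ⟨φ, hφ⟩ := hP
  obtain ⟨ψ, hψ⟩ := hQ
  exact ⟨φ ⊓ ψ, fun v => by simp [hφ, hψ]⟩

theorem or {P Q : (α → M) → Prop} (hP : IsDef P) (hQ : IsDef Q) : IsDef fun v => P v ∨ Q v := by
  obtain ⟨φ, hφ⟩ := hP
  obtain ⟨ψ, hψ⟩ := hQ
  exact ⟨φ ⊔ ψ, fun v => by simp [hφ, hψ]⟩

theorem iff {P Q : (α → M) → Prop} (hP : IsDef P) (hQ : IsDef Q) : IsDef fun v => (P v ↔ Q v) :=
  ((hP.imp hQ).and (hQ.imp hP)).congr fun _ => iff_def.symm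

theorem const (p : Prop) : IsDef fun _ : α → M => p := by
  by_cases h : p
  · exact ⟨⊤, fun v => by simp [h]⟩
  · exact ⟨⊥, fun v => by simp [h]⟩

theorem relabel {P : (α → M) → Prop} (hP : IsDef P) (g : α → β) :
    IsDef fun v : β → M => P fun a => v (g a) := by
  obtain ⟨φ, hφ⟩ := hP
  exact ⟨φ.relabel g, fun v => by simp only [Formula.realize_relabel, hφ]; rfl⟩

theorem forall_finite {ι : Type*} [Finite ι] {P : ι → (α → M) → Prop} (hP : ∀ i, IsDef (P i)) :
    IsDef fun v => ∀ i, P i v := by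
  choose φ hφ using hP
  exact ⟨Formula.iInf φ, fun v => by simp [hφ]⟩

theorem exists_tuple [Finite β] {P : (α → M) → (β → M) → Prop}
    (hP : IsDef fun w : α ⊕ β → M => P (fun a => w (.inl a)) (fun b => w (.inr b))) :
    IsDef fun v => ∃ y, P v y := by
  obtain ⟨φ, hφ⟩ := hP
  exact ⟨φ.iExs β, fun v => by simp [hφ]⟩

theorem ex {P : (α → M) → M → Prop}
    (hP : IsDef fun w : α ⊕ Unit → M => P (fun a => w (.inl a)) (w (.inr ()))) :
    IsDef fun v => ∃ x, P v x :=
  (exists_tuple (P := fun v y => P v (y ())) hP).congr fun _ =>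
    ⟨fun ⟨y, h⟩ => ⟨y (), h⟩, fun ⟨x, h⟩ => ⟨fun _ => x, h⟩⟩

theorem all {P : (α → M) → M → Prop}
    (hP : IsDef fun w : α ⊕ Unit → M => P (fun a => w (.inl a)) (w (.inr ()))) :
    IsDef fun v => ∀ x, P v x :=
  (ex (P := fun v x => ¬ P v x) hP.not).not.congr fun v => by push Not; rfl

/-- The values of the functions are introduced as existentially quantified variables, each
constrained by the definable graph; finiteness of `β` keeps this a first-order formula. -/
theorem subst [Finite β] {P : (β → M) → Prop} (hP : IsDef P) {f : β → (α → M) → M}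
    (hf : ∀ b, IsDefFun (f b)) : IsDef fun v => P fun b => f b v := by
  have h : IsDef fun v : α → M => ∃ y : β → M, (∀ b, f b v = y b) ∧ P y := by
    refine exists_tuple (P := fun v y => (∀ b, f b v = y b) ∧ P y) (and ?_ (hP.relabel Sum.inr))
    refine forall_finite fun b => ?_
    exact (hf b).relabel (Sum.elim Sum.inl fun _ => Sum.inr b)
  refine h.congr fun v => ⟨?_, fun h => ⟨_, fun _ => rfl, h⟩⟩
  rintro ⟨y, hy, h⟩
  rwa [show (fun b => f b v) = y from funext hy]

theorem subst₁ {P : M → Prop} (hP : IsDef fun v : Fin 1 → M => P (v 0))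
    {f : (α → M) → M} (hf : IsDefFun f) : IsDef fun v => P (f v) :=
  subst hP (f := ![f]) fun b => by fin_cases b; exact hf

theorem subst₂ {P : M → M → Prop} (hP : IsDef fun v : Fin 2 → M => P (v 0) (v 1))
    {f g : (α → M) → M} (hf : IsDefFun f) (hg : IsDefFun g) : IsDef fun v => P (f v) (g v) :=
  subst hP (f := ![f, g]) fun b => by fin_cases b <;> assumption

theorem subst₃ {P : M → M → M → Prop} (hP : IsDef fun v : Fin 3 → M => P (v 0) (v 1) (v 2))
    {f g h : (α → M) → M} (hf : IsDefFun f) (hg : IsDefFun g) (hh : IsDefFun h) :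
    IsDef fun v => P (f v) (g v) (h v) :=
  subst hP (f := ![f, g, h]) fun b => by fin_cases b <;> assumption

theorem subst₄ {P : M → M → M → M → Prop}
    (hP : IsDef fun v : Fin 4 → M => P (v 0) (v 1) (v 2) (v 3))
    {f g h k : (α → M) → M} (hf : IsDefFun f) (hg : IsDefFun g) (hh : IsDefFun h)
    (hk : IsDefFun k) : IsDef fun v => P (f v) (g v) (h v) (k v) :=
  subst hP (f := ![f, g, h, k]) fun b => by fin_cases b <;> assumption

theorem eq {f g : (α → M) → M} (hf : IsDefFun f) (hg : IsDefFun g) : IsDef fun v => f v = g v :=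
  subst₂ (P := fun x y => x = y) ⟨(Term.var 0).equal (Term.var 1), fun v => by simp⟩ hf hg

end IsDef

namespace IsDefFun

theorem var (a : α) : IsDefFun fun v : α → M => v a :=
  ⟨(Term.var (Sum.inl a)).equal (Term.var (Sum.inr ())), fun v => by simp⟩

theorem of_term (t : arith.Term α) : IsDefFun fun v : α → M => t.realize v :=
  ⟨(t.relabel Sum.inl).equal (Term.var (Sum.inr ())), fun v => by simp; rfl⟩

theorem comp [Finite β] {f : (β → M) → M} (hf : IsDefFun f) {g : β → (α → M) → M}
    (hg : ∀ b, IsDefFun (g b)) : IsDefFun fun v => f fun b => g b v :=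
  IsDef.subst (f := fun c : β ⊕ Unit => Sum.elim
      (fun b (w : α ⊕ Unit → M) => g b fun a => w (.inl a)) (fun _ w => w (.inr ())) c) hf <| by
    rintro (b | b)
    · exact (hg b).relabel (Sum.map Sum.inl id)
    · exact var _

theorem comp₁ {F : M → M} (hF : IsDefFun fun v : Fin 1 → M => F (v 0))
    {f : (α → M) → M} (hf : IsDefFun f) : IsDefFun fun v => F (f v) :=
  comp hF (g := ![f]) fun b => by fin_cases b; exact hf

theorem comp₂ {F : M → M → M} (hF : IsDefFun fun v : Fin 2 → M => F (v 0) (v 1))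
    {f g : (α → M) → M} (hf : IsDefFun f) (hg : IsDefFun g) : IsDefFun fun v => F (f v) (g v) :=
  comp hF (g := ![f, g]) fun b => by fin_cases b <;> assumption

end IsDefFun

end Definable

/-! ### Models of arithmetic as ordered semirings -/

/-- The arithmetic structure on `M` is given by its algebraic operations and its order. -/
class ArithOps (M : Type w) [arith.Structure M] [Zero M] [One M] [Add M] [Mul M] [LT M] :
    Prop where
  zero_eq : (Structure.funMap (L := arith) ArithFunc.zero ![] : M) = 0
  one_eq : (Structure.funMap (L := arith) ArithFunc.one ![] : M) = 1
  add_eq (x y : M) : Structure.funMap (L := arith) ArithFunc.add ![x, y] = x + y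
  mul_eq (x y : M) : Structure.funMap (L := arith) ArithFunc.mul ![x, y] = x * y
  lt_iff (x y : M) : Structure.RelMap (L := arith) ArithRel.lt ![x, y] ↔ x < y

/-- A discretely ordered semiring in which the induction scheme holds. -/
class ArithModel (M : Type w) [arith.Structure M] [CommSemiring M] [LinearOrder M] : Prop extends
    ArithOps M where
  one_le_of_pos (x : M) : 0 < x → 1 ≤ x
  induction {n : ℕ} (φ : arith.Formula (Fin n ⊕ Unit)) (p : Fin n → M)
    (zero : φ.Realize (Sum.elim p fun _ => 0))
    (succ : ∀ x, φ.Realize (Sum.elim p fun _ => x) → φ.Realize (Sum.elim p fun _ => x + 1))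
    (x : M) : φ.Realize (Sum.elim p fun _ => x)

section Ops

variable {M : Type w} [arith.Structure M] [Zero M] [One M] [Add M] [Mul M] [LT M] [ArithOps M]
  {α : Type}

@[simp]
theorem realize_zero (v : α → M) : (0 : arith.Term α).realize v = 0 := by
  rw [← ArithOps.zero_eq (M := M)]
  exact congrArg (Structure.funMap _) (Subsingleton.elim (α := Fin 0 → M) _ _)

@[simp]
theorem realize_one (v : α → M) : (1 : arith.Term α).realize v = 1 := by
  rw [← ArithOps.one_eq (M := M)]
  exact congrArg (Structure.funMap _) (Subsingleton.elim (α := Fin 0 → M) _ _)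

@[simp]
theorem realize_add (s t : arith.Term α) (v : α → M) :
    (s + t).realize v = s.realize v + t.realize v := by
  rw [← ArithOps.add_eq (M := M)]
  exact Term.realize_functions_apply₂

@[simp]
theorem realize_mul (s t : arith.Term α) (v : α → M) :
    (s * t).realize v = s.realize v * t.realize v := by
  rw [← ArithOps.mul_eq (M := M)]
  exact Term.realize_functions_apply₂

@[simp]
theorem realize_lt {n : ℕ} (s t : arith.Term (α ⊕ Fin n)) (v : α → M) (x : Fin n → M) :
    (lt s t).Realize v x ↔ s.realize (Sum.elim v x) < t.realize (Sum.elim v x) := by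
  rw [← ArithOps.lt_iff]
  exact BoundedFormula.realize_rel₂

end Ops

section Basic

variable {M : Type w} [arith.Structure M] [CommSemiring M] [LinearOrder M] [ArithModel M]
  {α : Type}

theorem IsDefFun.zero : IsDefFun fun _ : α → M => 0 := by
  simpa using of_term (M := M) (0 : arith.Term α)

theorem IsDefFun.one : IsDefFun fun _ : α → M => 1 := by
  simpa using of_term (M := M) (1 : arith.Term α)

theorem IsDefFun.add {f g : (α → M) → M} (hf : IsDefFun f) (hg : IsDefFun g) :
    IsDefFun fun v => f v + g v :=
  comp₂ (F := (· + ·)) (by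
    have := of_term (M := M) (Term.var 0 + Term.var 1 : arith.Term (Fin 2))
    simp only [realize_add] at this
    exact this) hf hg

theorem IsDefFun.mul {f g : (α → M) → M} (hf : IsDefFun f) (hg : IsDefFun g) :
    IsDefFun fun v => f v * g v :=
  comp₂ (F := (· * ·)) (by
    have := of_term (M := M) (Term.var 0 * Term.var 1 : arith.Term (Fin 2))
    simp only [realize_mul] at this
    exact this) hf hg

theorem IsDefFun.natCast (k : ℕ) : IsDefFun fun _ : α → M => (k : M) := by
  induction k with
  | zero => simpa using zero
  | succ k ih => simpa using ih.add one

theorem IsDef.lt {f g : (α → M) → M} (hf : IsDefFun f) (hg : IsDefFun g) :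
    IsDef fun v => f v < g v :=
  subst₂ (P := fun x y => x < y) ⟨Relations.formula₂ (L := arith) ArithRel.lt (Term.var 0)
    (Term.var 1), fun _ => Formula.realize_rel₂.trans (ArithOps.lt_iff _ _)⟩ hf hg

/-- The two parameters will be the two sides of a game position, and the induction variable the
depth of the final test. -/
theorem induction_of_isDef {P : M → M → M → Prop}
    (hP : IsDef fun v : Fin 3 → M => P (v 0) (v 1) (v 2)) (a b : M) (zero : P 0 a b)
    (succ : ∀ x, P x a b → P (x + 1) a b) (x : M) : P x a b := by
  obtain ⟨φ, hφ⟩ := hP.relabel (β := Fin 2 ⊕ Unit) ![.inr (), .inl 0, .inl 1]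
  have key : ∀ y, φ.Realize (Sum.elim ![a, b] fun _ => y) ↔ P y a b := fun y => by
    rw [hφ]; simp
  rw [← key]
  refine ArithModel.induction φ ![a, b] ((key _).2 zero) (fun y hy => ?_) x
  rw [key] at hy ⊢
  exact succ y hy

/-- Overspill: a definable set that contains all standard numbers contains a nonstandard one. -/
theorem overspill {P : M → M → M → Prop}
    (hP : IsDef fun v : Fin 3 → M => P (v 0) (v 1) (v 2)) (a b : M)
    (hM : ∃ x : M, ∀ k : ℕ, x ≠ k) (h : ∀ k : ℕ, P k a b) :
    ∃ x : M, (∀ k : ℕ, x ≠ k) ∧ P x a b := by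
  by_contra! hc
  obtain ⟨x, hx⟩ := hM
  -- If only standard numbers satisfied `P`, then `P` would define the standard cut, which contains
  -- 0 and is closed under successor; induction would put `x` in it.
  refine hc x hx (induction_of_isDef hP a b (by simpa using h 0) (fun y hy => ?_) x)
  by_cases hy' : ∃ k : ℕ, y = k
  · obtain ⟨k, rfl⟩ := hy'
    simpa using h (k + 1)
  · exact absurd hy (hc y (by simpa using hy'))

end Basic

-- The ordered semiring carried by a model of PA

section OfPA

variable {M : Type w} [arith.Structure M]

theorem induction_of_PA [Zero M] [One M] [Add M] [Mul M] [LT M] [ArithOps M] (h : M ⊨ PA)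
    {n : ℕ} (φ : arith.Formula (Fin n ⊕ Unit))
    (p : Fin n → M) (zero : φ.Realize (Sum.elim p fun _ => 0))
    (succ : ∀ x, φ.Realize (Sum.elim p fun _ => x) → φ.Realize (Sum.elim p fun _ => x + 1))
    (x : M) : φ.Realize (Sum.elim p fun _ => x) := by
  have h1 := h.realize_of_mem (inductionAxiom φ) (Or.inr ⟨n, φ, rfl⟩)
  simp only [inductionAxiom, Sentence.Realize, Formula.realize_iAlls, Formula.realize_relabel] at h1
  have h2 := h1 p
  rw [Formula.realize_imp, Formula.realize_imp, Formula.realize_iAlls, Formula.realize_iAlls] at h2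
  refine h2 ?_ (fun y => ?_) (fun _ => x)
  · rw [Formula.Realize, BoundedFormula.realize_subst]
    convert zero
    refine iff_of_eq (congrArg (fun v => Formula.Realize φ v) ?_)
    ext (i | i) <;> simp
  · rw [Formula.realize_imp, Formula.Realize, Formula.Realize, BoundedFormula.realize_subst]
    intro hy
    have hy' := succ (y ()) hy
    convert hy'
    refine iff_of_eq (congrArg (fun v => Formula.Realize φ v) ?_)
    ext (i | i) <;> simp

theorem realize_discreteOrderedSemiring [Zero M] [One M] [Add M] [Mul M] [LT M] [ArithOps M]
    (h : M ⊨ PA) :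
    (∀ x y z : M, x + y + z = x + (y + z)) ∧ (∀ x y : M, x + y = y + x) ∧
    (∀ x y z : M, x * y * z = x * (y * z)) ∧ (∀ x y : M, x * y = y * x) ∧
    (∀ x y z : M, x * (y + z) = x * y + x * z) ∧ (∀ x : M, x + 0 = x) ∧ (∀ x : M, x * 0 = 0) ∧
    (∀ x : M, x * 1 = x) ∧ (∀ x y z : M, x < y → y < z → x < z) ∧ (∀ x : M, ¬ x < x) ∧
    (∀ x y : M, (x < y ∨ x = y) ∨ y < x) ∧ (∀ x y z : M, x < y → x + z < y + z) ∧
    (∀ x y z : M, 0 < z → x < y → x * z < y * z) ∧ (∀ x y : M, x < y → ∃ z, x + z = y) ∧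
    (0 : M) < 1 ∧ (∀ x : M, 0 < x → 1 < x ∨ 1 = x) ∧ ∀ x : M, 0 < x ∨ 0 = x := by
  have hax := h.mono Set.subset_union_left
  simp [discreteOrderedSemiring, all₁, all₂, all₃, Sentence.Realize, Formula.Realize,
    Fin.snoc] at hax
  exact hax

theorem exists_orderedSemiring_of_PA (h : M ⊨ PA) :
    ∃ (_ : CommSemiring M) (_ : LinearOrder M),
      IsStrictOrderedRing M ∧ CanonicallyOrderedAdd M ∧ ArithModel M := by
  classical
  let : Zero M := ⟨Structure.funMap (L := arith) ArithFunc.zero ![]⟩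
  let : One M := ⟨Structure.funMap (L := arith) ArithFunc.one ![]⟩
  let : Add M := ⟨fun x y => Structure.funMap (L := arith) ArithFunc.add ![x, y]⟩
  let : Mul M := ⟨fun x y => Structure.funMap (L := arith) ArithFunc.mul ![x, y]⟩
  let : LT M := ⟨fun x y => Structure.RelMap (L := arith) ArithRel.lt ![x, y]⟩
  have hops : ArithOps M := ⟨rfl, rfl, fun _ _ => rfl, fun _ _ => rfl, fun _ _ => Iff.rfl⟩
  obtain ⟨add_assoc', add_comm', mul_assoc', mul_comm', mul_add', add_zero', mul_zero', mul_one',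
    lt_trans', lt_irrefl', trichotomy, add_lt', mul_lt', exists_add, zero_lt_one', one_le,
    zero_le'⟩ := realize_discreteOrderedSemiring h
  let iS : CommSemiring M :=
    { add_assoc := add_assoc'
      add_comm := add_comm'
      zero_add := fun x => (add_comm' 0 x).trans (add_zero' x)
      add_zero := add_zero'
      mul_assoc := mul_assoc'
      mul_comm := mul_comm'
      mul_one := mul_one'
      one_mul := fun x => (mul_comm' 1 x).trans (mul_one' x)
      mul_zero := mul_zero'
      zero_mul := fun x => (mul_comm' 0 x).trans (mul_zero' x)
      left_distrib := mul_add'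
      right_distrib := fun x y z => by
        rw [mul_comm' (x + y) z, mul_add', mul_comm' z x, mul_comm' z y]
      nsmul := nsmulRec
      npow := npowRec }
  let iL : LinearOrder M :=
    { le := fun x y => x < y ∨ x = y
      le_refl := fun x => Or.inr rfl
      le_trans := by
        rintro x y z (hxy | rfl) (hyz | rfl)
        · exact Or.inl (lt_trans' _ _ _ hxy hyz)
        · exact Or.inl hxy
        · exact Or.inl hyz
        · exact Or.inr rfl
      lt_iff_le_not_ge := fun x y => by
        refine ⟨fun hxy => ⟨Or.inl hxy, ?_⟩, ?_⟩
        · rintro (hyx | rfl)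
          · exact lt_irrefl' _ (lt_trans' _ _ _ hxy hyx)
          · exact lt_irrefl' _ hxy
        · rintro ⟨hxy | rfl, hn⟩
          · exact hxy
          · exact absurd (Or.inr rfl) hn
      le_antisymm := by
        rintro x y (hxy | rfl) (hyx | hyx)
        · exact absurd (lt_trans' _ _ _ hxy hyx) (lt_irrefl' _)
        · exact hyx.symm
        · rfl
        · rfl
      le_total := fun x y => by
        rcases trichotomy x y with (hxy | hxy) | hxy
        · exact Or.inl (Or.inl hxy)
        · exact Or.inl (Or.inr hxy)
        · exact Or.inr (Or.inl hxy)
      toDecidableLE := Classical.decRel _ }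
  have add_le' : ∀ a b : M, a ≤ b → ∀ c, a + c ≤ b + c := by
    rintro a b (hab | rfl) c
    · exact Or.inl (add_lt' _ _ _ hab)
    · exact Or.inr rfl
  refine ⟨iS, iL, ?_, ?_, ?_⟩
  · exact
    { add_le_add_left := add_le'
      le_of_add_le_add_left := fun a b c hbc => by
        by_contra hcb
        have := add_lt' _ _ a (not_le.1 hcb)
        rw [add_comm' c, add_comm' b] at this
        exact absurd hbc (not_le.2 this)
      zero_le_one := Or.inl zero_lt_one'
      exists_pair_ne := ⟨0, 1, fun h01 => lt_irrefl' (0 : M) (h01 ▸ zero_lt_one')⟩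
      mul_lt_mul_of_pos_left := fun a ha b c hbc => by
        have := mul_lt' _ _ _ ha hbc
        rwa [mul_comm' b, mul_comm' c] at this
      mul_lt_mul_of_pos_right := fun a ha b c hbc => mul_lt' _ _ _ ha hbc }
  · have key : ∀ a b : M, a ≤ b + a := fun a b => by
      have := add_le' 0 b (zero_le' b) a
      rwa [add_comm' 0 a, add_zero'] at this
    exact
    { exists_add_of_le := by
        rintro a b (hab | rfl)
        · obtain ⟨c, hc⟩ := exists_add _ _ hab
          exact ⟨c, hc.symm⟩
        · exact ⟨0, (add_zero' _).symm⟩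
      le_add_self := key
      le_self_add := fun a b => by rw [add_comm']; exact key a b }
  · exact
    { hops with
      one_le_of_pos := one_le
      induction := fun φ p zero succ x => induction_of_PA h φ p zero succ x }

end OfPA

/-! ### Pairs and finite sequences in models of arithmetic -/

section Coding

variable {M : Type w} [CommSemiring M]

/-- An injective pairing polynomial. -/
def pair (x y : M) : M := (x + y) * (x + y) + x

open Classical in
/-- The first component of the pair coded by `z`. -/
noncomputable def fst (z : M) : M := if h : ∃ x y, z = pair x y then h.choose else 0

open Classical in
/-- The second component of the pair coded by `z`. -/
noncomputable def snd (z : M) : M := if h : ∃ y x, z = pair x y then h.choose else 0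

/-- Gödel's beta function, as a relation: `x` is the `i`-th entry of the sequence coded by
`u` and `v`. -/
def Beta [LT M] (u v i x : M) : Prop :=
  ∃ q, u = q * (1 + (i + 1) * v) + x ∧ x < 1 + (i + 1) * v

variable [arith.Structure M] [LinearOrder M] [IsStrictOrderedRing M] [CanonicallyOrderedAdd M]
  [ArithModel M] {α : Type}

theorem add_one_le_of_lt {x y : M} (h : x < y) : x + 1 ≤ y := by
  obtain ⟨z, rfl⟩ := exists_add_of_le h.le
  gcongr
  refine ArithModel.one_le_of_pos z ?_
  simpa using h

/-- Discreteness gives `q + 1 ≤ q'`, and a remainder below `m` cannot bridge the gap. Uniqueness of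
division with remainder, hence `beta_unique`, follows. -/
theorem mul_add_lt_mul_add_of_lt {q q' m x y : M} (h : q < q') (hx : x < m) :
    q * m + x < q' * m + y :=
  calc q * m + x < q * m + m := by gcongr
    _ = (q + 1) * m := by ring
    _ ≤ q' * m := by gcongr; exact add_one_le_of_lt h
    _ ≤ q' * m + y := le_self_add

theorem beta_unique {u v i x y : M} (hx : Beta u v i x) (hy : Beta u v i y) : x = y := by
  obtain ⟨q, hq, hx⟩ := hx
  obtain ⟨q', hq', hy⟩ := hy
  have h := hq.symm.trans hq'
  rcases lt_trichotomy q q' with hlt | rfl | hlt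
  · exact absurd h (mul_add_lt_mul_add_of_lt hlt hx).ne
  · exact add_left_cancel h
  · exact absurd h (mul_add_lt_mul_add_of_lt hlt hy).ne'

theorem exists_natCast_of_lt {x : M} {n : ℕ} (h : x < n) : ∃ k : ℕ, k < n ∧ x = k := by
  induction n with
  | zero => simp at h
  | succ n ih =>
    rcases lt_trichotomy x n with hx | hx | hx
    · obtain ⟨k, hk, rfl⟩ := ih hx
      exact ⟨k, by omega, rfl⟩
    · exact ⟨n, by omega, hx⟩
    · have := add_one_le_of_lt hx
      push_cast at h
      exact absurd h this.not_gt

/-- The code of `(x, y)` lies between the consecutive squares `(x + y)²` and `(x + y + 1)²`, so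
codes with different sums lie in disjoint intervals. -/
theorem pair_lt_pair_of_lt {x y x' y' : M} (h : x + y < x' + y') : pair x y < pair x' y' := by
  have h1 := add_one_le_of_lt h
  calc pair x y < (x + y) * (x + y) + x + (x + y + y + 1) := by
        refine lt_add_of_pos_right _ ?_
        positivity
    _ = (x + y + 1) * (x + y + 1) := by ring
    _ ≤ (x' + y') * (x' + y') := by gcongr
    _ ≤ pair x' y' := le_self_add

theorem pair_injective {x y x' y' : M} (h : pair x y = pair x' y') : x = x' ∧ y = y' := by
  have hs : x + y = x' + y' := by
    rcases lt_trichotomy (x + y) (x' + y') with hlt | heq | hlt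
    · exact absurd h (pair_lt_pair_of_lt hlt).ne
    · exact heq
    · exact absurd h (pair_lt_pair_of_lt hlt).ne'
  rw [pair, pair, hs] at h
  have hx := add_left_cancel h
  subst hx
  exact ⟨rfl, add_left_cancel hs⟩

@[simp]
theorem fst_pair (x y : M) : fst (pair x y) = x := by
  have h : ∃ x' y', pair x y = pair x' y' := ⟨x, y, rfl⟩
  rw [fst, dif_pos h]
  obtain ⟨y', hy'⟩ := h.choose_spec
  exact (pair_injective hy').1.symm

@[simp]
theorem snd_pair (x y : M) : snd (pair x y) = y := by
  have h : ∃ y' x', pair x y = pair x' y' := ⟨y, x, rfl⟩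
  rw [snd, dif_pos h]
  obtain ⟨x', hx'⟩ := h.choose_spec
  exact (pair_injective hx').2.symm

/-- A first-order description of the graph, including the default value 0 off the range of `pair`;
it replaces the choice in the definition when proving definability. -/
theorem fst_eq_iff (z x : M) :
    fst z = x ↔ (∃ y, z = pair x y) ∨ (¬ ∃ x y, z = pair x y) ∧ x = 0 := by
  by_cases h : ∃ x y, z = pair x y
  · obtain ⟨a, b, rfl⟩ := h
    rw [fst_pair]
    constructor
    · rintro rfl
      exact Or.inl ⟨b, rfl⟩
    · rintro (⟨y, hy⟩ | ⟨hn, -⟩)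
      · exact (pair_injective hy).1
      · exact absurd ⟨a, b, rfl⟩ hn
  · rw [fst, dif_neg h]
    constructor
    · rintro rfl
      exact Or.inr ⟨h, rfl⟩
    · rintro (⟨y, hy⟩ | ⟨-, rfl⟩)
      · exact absurd ⟨x, y, hy⟩ h
      · rfl

theorem snd_eq_iff (z y : M) :
    snd z = y ↔ (∃ x, z = pair x y) ∨ (¬ ∃ y x, z = pair x y) ∧ y = 0 := by
  by_cases h : ∃ y x, z = pair x y
  · obtain ⟨b, a, rfl⟩ := h
    rw [snd_pair]
    constructor
    · rintro rfl
      exact Or.inl ⟨a, rfl⟩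
    · rintro (⟨x, hx⟩ | ⟨hn, -⟩)
      · exact (pair_injective hx).2
      · exact absurd ⟨b, a, rfl⟩ hn
  · rw [snd, dif_neg h]
    constructor
    · rintro rfl
      exact Or.inr ⟨h, rfl⟩
    · rintro (⟨x, hx⟩ | ⟨-, rfl⟩)
      · exact absurd ⟨y, x, hx⟩ h
      · rfl

end Coding

-- Definability of pairing and of the beta function

section Definability

variable {M : Type w} [CommSemiring M] [arith.Structure M] [LinearOrder M] [ArithModel M]
  {α : Type}

theorem IsDefFun.pair {f g : (α → M) → M} (hf : IsDefFun f) (hg : IsDefFun g) :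
    IsDefFun fun v => pair (f v) (g v) :=
  ((hf.add hg).mul (hf.add hg)).add hf

theorem isDef_beta {f g h k : (α → M) → M} (hf : IsDefFun f) (hg : IsDefFun g)
    (hh : IsDefFun h) (hk : IsDefFun k) : IsDef fun v => Beta (f v) (g v) (h v) (k v) := by
  refine IsDef.subst₄ (P := Beta) (.ex (.and (.eq (.var _) ?_) (.lt (.var _) ?_))) hf hg hh hk
  · exact .add (.mul (.var _) (.add .one (.mul (.add (.var _) .one) (.var _)))) (.var _)
  · exact .add .one (.mul (.add (.var _) .one) (.var _))

variable [IsStrictOrderedRing M] [CanonicallyOrderedAdd M]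

theorem IsDefFun.fst {f : (α → M) → M} (hf : IsDefFun f) : IsDefFun fun v => fst (f v) := by
  refine comp₁ (F := arith.fst) ?_ hf
  refine IsDef.congr ?_ fun w => (fst_eq_iff (w (.inl 0)) (w (.inr ()))).symm
  refine .or (.ex (.eq (var _) (pair (var _) (var _))))
    (.and (.not (.ex (.ex ?_))) (.eq (var _) zero))
  exact .eq (var _) (pair (var _) (var _))

theorem IsDefFun.snd {f : (α → M) → M} (hf : IsDefFun f) : IsDefFun fun v => snd (f v) := by
  refine comp₁ (F := arith.snd) ?_ hf
  refine IsDef.congr ?_ fun w => (snd_eq_iff (w (.inl 0)) (w (.inr ()))).symm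
  refine .or (.ex (.eq (var _) (pair (var _) (var _))))
    (.and (.not (.ex (.ex ?_))) (.eq (var _) zero))
  exact .eq (var _) (pair (var _) (var _))

end Definability

-- The Chinese remainder theorem without subtraction

section CRT

variable {M : Type w} [CommSemiring M]

theorem exists_mul_eq_mul_add_one {v w y : M} {i d : ℕ} (hv : v = d * w)
    (hy : (((i + d : ℕ) : M) + 1) * v = y + 1) :
    ∃ s t : M, s * (1 + (i + 1) * v) = t * (1 + (((i + d : ℕ) : M) + 1) * v) + 1 := by
  push_cast at hy ⊢
  -- Put `K = i + d + 1` and work modulo `1 + K * v`, where `K * v = y + 1` is `-1`. Then `K * (1 +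
  -- (i + 1) * v)` is `K - (i + 1) = d`; multiplying by `w * K` gives `K * v`, that is `-1`, and the
  -- factor `y + 1` turns it into `1`.
  refine ⟨(y + 1) * w * (i + d + 1) * (i + d + 1), y + (y + 1) * w * (i + d + 1) * (i + 1), ?_⟩
  calc (y + 1) * w * (i + d + 1) * (i + d + 1) * (1 + (i + 1) * v)
      = (y + 1) * ((i + d + 1) * (d * w)) +
        (y + 1) * w * (i + d + 1) * (i + 1) * (1 + (i + d + 1) * v) := by ring
    _ = (y + 1) * (y + 1) + (y + 1) * w * (i + d + 1) * (i + 1) * (1 + (y + 1)) := by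
      rw [← hv, hy]
    _ = (y + (y + 1) * w * (i + d + 1) * (i + 1)) * (1 + (y + 1)) + 1 := by ring
    _ = _ := by rw [hy]

theorem exists_prod_mul_eq_mul_add_one {ι : Type*} (s : Finset ι) (m : ι → M) (k : M)
    (h : ∀ i ∈ s, ∃ a b, a * m i = b * k + 1) : ∃ a b, a * ∏ i ∈ s, m i = b * k + 1 := by
  classical
  induction s using Finset.induction_on with
  | empty => exact ⟨1, 0, by simp⟩
  | insert i s hi ih =>
    obtain ⟨a, b, hab⟩ := ih fun j hj => h j (Finset.mem_insert_of_mem hj)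
    obtain ⟨a', b', hab'⟩ := h i (Finset.mem_insert_self i s)
    refine ⟨a' * a, b' * b * k + b' + b, ?_⟩
    rw [Finset.prod_insert hi]
    calc a' * a * (m i * ∏ j ∈ s, m j) = (a' * m i) * (a * ∏ j ∈ s, m j) := by ring
      _ = _ := by rw [hab, hab']; ring

theorem exists_simultaneous_residue {n : ℕ} {v : M} (hdvd : ∀ d : ℕ, 0 < d → d ≤ n → (d : M) ∣ v)
    (hpos : ∀ k : ℕ, ∃ y : M, ((k : M) + 1) * v = y + 1) (x : ℕ → M) (k : ℕ) (hk : k ≤ n) :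
    ∃ u, ∀ i < k, ∃ q, u = q * (1 + ((i : M) + 1) * v) + x i := by
  induction k with
  | zero => exact ⟨0, by simp⟩
  | succ k ih =>
    obtain ⟨u, hu⟩ := ih (by omega)
    obtain ⟨y, hy⟩ := hpos k
    obtain ⟨s, t, hst⟩ := exists_prod_mul_eq_mul_add_one (Finset.range k)
      (fun i : ℕ => 1 + ((i : M) + 1) * v) (1 + ((k : M) + 1) * v) fun i hi => by
        obtain ⟨d, rfl⟩ := Nat.exists_eq_add_of_lt (Finset.mem_range.1 hi)
        obtain ⟨w, hw⟩ := hdvd (d + 1) (by omega) (by omega)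
        exact exists_mul_eq_mul_add_one (i := i) (d := d + 1) hw hy
    -- The added multiple of the earlier moduli keeps the earlier residues. Modulo the new modulus,
    -- `s` inverts their product and `(k + 1) * v` is `-1`, so the correction amounts to `x k - u`.
    refine ⟨u + (∏ i ∈ Finset.range k, (1 + ((i : M) + 1) * v)) *
      (s * (x k + (k + 1) * v * u)), fun i hi => ?_⟩
    rcases Nat.lt_succ_iff_lt_or_eq.1 hi with hi | rfl
    · obtain ⟨q, hq⟩ := hu i hi
      obtain ⟨r, hr⟩ := Finset.dvd_prod_of_mem (fun i : ℕ => 1 + ((i : M) + 1) * v)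
        (Finset.mem_range.2 hi)
      rw [hr]
      refine ⟨q + r * (s * (x k + (k + 1) * v * u)), ?_⟩
      calc _ = (q * (1 + ((i : M) + 1) * v) + x i) +
            (1 + ((i : M) + 1) * v) * r * (s * (x k + (k + 1) * v * u)) := by rw [← hq]
        _ = _ := by ring
    · refine ⟨u + t * (x i + (i + 1) * v * u), ?_⟩
      calc _ = u + (s * ∏ j ∈ Finset.range i, (1 + ((j : M) + 1) * v)) *
            (x i + (i + 1) * v * u) := by ring
        _ = _ := by rw [hst]; ring

end CRT

section Sequences

variable {M : Type w} [CommSemiring M] [arith.Structure M] [LinearOrder M] [IsStrictOrderedRing M]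
  [CanonicallyOrderedAdd M] [ArithModel M]

/-- Every sequence of standard finite length is coded. -/
theorem exists_beta (n : ℕ) (x : ℕ → M) :
    ∃ u v : M, ∀ i < n, ∀ y, Beta u v i y ↔ y = x i := by
  -- The factorial makes differences of indices divide `v`, as the inversion of the moduli requires;
  -- the other factor makes every modulus exceed the entry it must hold.
  set v : M := (n.factorial : M) * (∑ i ∈ Finset.range n, x i + 1) with hv
  have hle : ∀ i < n, x i < 1 + ((i : M) + 1) * v := fun i hi => by
    have h1 : (1 : M) ≤ n.factorial := by exact_mod_cast n.factorial_pos
    calc x i ≤ ∑ i ∈ Finset.range n, x i :=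
          Finset.single_le_sum (fun _ _ => zero_le) (Finset.mem_range.2 hi)
      _ ≤ 1 * (1 * (∑ i ∈ Finset.range n, x i + 1)) := by simp
      _ ≤ ((i : M) + 1) * v := by
        rw [hv]
        gcongr
        exact le_add_self
      _ < 1 + ((i : M) + 1) * v := lt_add_of_pos_left _ one_pos
  obtain ⟨u, hu⟩ := exists_simultaneous_residue (n := n) (v := v)
    (fun d hd hdn => (Nat.cast_dvd_cast (Nat.dvd_factorial hd hdn)).mul_right _)
    (fun k => by
      have : (1 : M) ≤ ((k : M) + 1) * v := ArithModel.one_le_of_pos _ (by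
        have : (0 : M) < n.factorial := by exact_mod_cast n.factorial_pos
        positivity)
      obtain ⟨y, hy⟩ := exists_add_of_le this
      exact ⟨y, by rw [hy, add_comm]⟩) x n le_rfl
  refine ⟨u, v, fun i hi y => ?_⟩
  obtain ⟨q, hq⟩ := hu i hi
  have hb : Beta u v i (x i) := ⟨q, hq, hle i hi⟩
  exact ⟨fun hy => beta_unique hy hb, fun hy => hy ▸ hb⟩

end Sequences

/-! ### The arithmetic functions of bounded depth -/

section Level

variable {M : Type w} [CommSemiring M]

/-- The unary functions that are obtained from the identity and the constants `0` and `1` by at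
most `j` nested applications of addition, multiplication and the two projections of pairs. -/
def level : ℕ → Set (M → M)
  | 0 => {fun x => x, fun _ => 0, fun _ => 1}
  | j + 1 => level j ∪ Set.image2 (fun f g x => f x + g x) (level j) (level j) ∪
      Set.image2 (fun f g x => f x * g x) (level j) (level j) ∪
      (fun f x => fst (f x)) '' level j ∪ (fun f x => snd (f x)) '' level j

theorem mem_level_succ {j : ℕ} {h : M → M} : h ∈ level (j + 1) ↔
    h ∈ level j ∨ (∃ f ∈ level j, ∃ g ∈ level j, (fun x => f x + g x) = h) ∨
      (∃ f ∈ level j, ∃ g ∈ level j, (fun x => f x * g x) = h) ∨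
      (∃ f ∈ level j, (fun x => fst (f x)) = h) ∨ ∃ f ∈ level j, (fun x => snd (f x)) = h := by
  simp only [level, Set.mem_union, Set.mem_image2, Set.mem_image, or_assoc]

theorem level_mono : Monotone (level : ℕ → Set (M → M)) :=
  monotone_nat_of_le_succ fun _ _ h => mem_level_succ.2 (Or.inl h)

/-- This finiteness makes the agreement relation of standard depth codable, and the game invariant
finite-valued. -/
theorem finite_level (j : ℕ) : (level j : Set (M → M)).Finite := by
  induction j with
  | zero => simp [level]
  | succ j ih =>
    exact (((ih.union (ih.image2 _ ih)).union (ih.image2 _ ih)).union (ih.image _)).union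
      (ih.image _)

/-- The functions obtained from the identity and the constants `0` and `1` by addition,
multiplication and the two projections of pairs. -/
def IsElem (f : M → M) : Prop := ∃ j, f ∈ level j

namespace IsElem

theorem id : IsElem fun x : M => x := ⟨0, by simp [level]⟩

theorem zero : IsElem fun _ : M => (0 : M) := ⟨0, by simp [level]⟩

theorem one : IsElem fun _ : M => (1 : M) := ⟨0, by simp [level]⟩

theorem exists_common {f g : M → M} (hf : IsElem f) (hg : IsElem g) :
    ∃ j, f ∈ level j ∧ g ∈ level j := by
  obtain ⟨i, hi⟩ := hf
  obtain ⟨j, hj⟩ := hg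
  exact ⟨max i j, level_mono (le_max_left i j) hi, level_mono (le_max_right i j) hj⟩

theorem add {f g : M → M} (hf : IsElem f) (hg : IsElem g) : IsElem fun x => f x + g x := by
  obtain ⟨j, hf, hg⟩ := exists_common hf hg
  exact ⟨j + 1, mem_level_succ.2 (.inr (.inl ⟨f, hf, g, hg, rfl⟩))⟩

theorem mul {f g : M → M} (hf : IsElem f) (hg : IsElem g) : IsElem fun x => f x * g x := by
  obtain ⟨j, hf, hg⟩ := exists_common hf hg
  exact ⟨j + 1, mem_level_succ.2 (.inr (.inr (.inl ⟨f, hf, g, hg, rfl⟩)))⟩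

theorem fst {f : M → M} (hf : IsElem f) : IsElem fun x => fst (f x) := by
  obtain ⟨j, hf⟩ := hf
  exact ⟨j + 1, mem_level_succ.2 (.inr (.inr (.inr (.inl ⟨f, hf, rfl⟩))))⟩

theorem snd {f : M → M} (hf : IsElem f) : IsElem fun x => snd (f x) := by
  obtain ⟨j, hf⟩ := hf
  exact ⟨j + 1, mem_level_succ.2 (.inr (.inr (.inr (.inr ⟨f, hf, rfl⟩))))⟩

/-- After a move the position is a pair, and functions of the old position are read off through
`fst`; closure under composition keeps them elementary. -/
theorem comp {f g : M → M} (hf : IsElem f) (hg : IsElem g) : IsElem fun x => f (g x) := by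
  obtain ⟨j, hf⟩ := hf
  induction j generalizing f with
  | zero =>
    obtain rfl | rfl | rfl := hf
    exacts [hg, zero, one]
  | succ j ih =>
    rw [mem_level_succ] at hf
    rcases hf with hf | ⟨f, hf, h, hh, rfl⟩ | ⟨f, hf, h, hh, rfl⟩ | ⟨f, hf, rfl⟩ |
      ⟨f, hf, rfl⟩
    exacts [ih hf, (ih hf).add (ih hh), (ih hf).mul (ih hh), (ih hf).fst, (ih hf).snd]

end IsElem

variable [arith.Structure M] [LinearOrder M] [IsStrictOrderedRing M] [CanonicallyOrderedAdd M]
  [ArithModel M] {α : Type}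

theorem IsElem.isDefFun {f : M → M} (hf : IsElem f) {g : (α → M) → M} (hg : IsDefFun g) :
    IsDefFun fun v => f (g v) := by
  obtain ⟨j, hf⟩ := hf
  induction j generalizing f with
  | zero =>
    obtain rfl | rfl | rfl := hf
    exacts [hg, .zero, .one]
  | succ j ih =>
    rw [mem_level_succ] at hf
    rcases hf with hf | ⟨f, hf, h, hh, rfl⟩ | ⟨f, hf, h, hh, rfl⟩ | ⟨f, hf, rfl⟩ |
      ⟨f, hf, rfl⟩
    exacts [ih hf, (ih hf).add (ih hh), (ih hf).mul (ih hh), (ih hf).fst, (ih hf).snd]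

end Level

/-! ### Coding tuples by elements -/

section Tuples

variable {M : Type w} [CommSemiring M]

/-- The code of a tuple. -/
def encode : ∀ {n : ℕ}, (Fin n → M) → M
  | 0, _ => 0
  | _ + 1, v => pair (v 0) (encode fun i => v i.succ)

/-- The `i`-th entry of the tuple coded by an element. -/
noncomputable def entry : ℕ → M → M
  | 0, z => fst z
  | i + 1, z => entry i (snd z)

theorem isElem_entry (i : ℕ) : IsElem (entry i : M → M) := by
  induction i with
  | zero => exact IsElem.id.fst
  | succ i ih => exact ih.comp IsElem.id.snd

variable [arith.Structure M] [LinearOrder M] [ArithModel M] {α : Type}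

theorem isDefFun_encode {n : ℕ} (g : Fin n → α) :
    IsDefFun fun v : α → M => encode fun i => v (g i) := by
  induction n with
  | zero => exact .zero
  | succ n ih => exact .pair (.var _) (ih fun i => g i.succ)

variable [IsStrictOrderedRing M] [CanonicallyOrderedAdd M]

@[simp]
theorem entry_encode {n : ℕ} (v : Fin n → M) (i : Fin n) : entry i (encode v) = v i := by
  induction n with
  | zero => exact i.elim0
  | succ n ih =>
    refine Fin.cases ?_ (fun i => ?_) i
    · simp [entry, encode]
    · simp [entry, encode, ih]

end Tuples

/-! ### Coded finite relations -/

section Mem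

variable {M : Type w} [CommSemiring M] [LinearOrder M]

/-- The triple `(j, x, y)` belongs to the finite ternary relation coded by `c`. -/
def Mem (c j x y : M) : Prop :=
  ∃ i, i < fst c ∧ Beta (fst (snd c)) (snd (snd c)) i (pair j (pair x y))

variable [arith.Structure M] [IsStrictOrderedRing M] [CanonicallyOrderedAdd M]
  [ArithModel M] {α : Type}

theorem isDef_mem {f g h k : (α → M) → M} (hf : IsDefFun f) (hg : IsDefFun g)
    (hh : IsDefFun h) (hk : IsDefFun k) : IsDef fun v => Mem (f v) (g v) (h v) (k v) := by
  refine IsDef.subst₄ (P := Mem) (.ex (.and (.lt (.var _) (.fst (.var _))) ?_)) hf hg hh hk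
  exact isDef_beta (.fst (.snd (.var _))) (.snd (.snd (.var _))) (.var _)
    (.pair (.var _) (.pair (.var _) (.var _)))

theorem exists_forall_mem_iff {F : Set (M × M × M)} (hF : F.Finite) :
    ∃ c, ∀ j x y, Mem c j x y ↔ (j, x, y) ∈ F := by
  set l : List M := hF.toFinset.toList.map fun t => pair t.1 (pair t.2.1 t.2.2) with hl
  obtain ⟨u, v, huv⟩ := exists_beta l.length fun i => l.getD i 0
  refine ⟨pair l.length (pair u v), fun j x y => ?_⟩
  have hmem : pair j (pair x y) ∈ l ↔ (j, x, y) ∈ F := by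
    simp only [hl, List.mem_map, Finset.mem_toList, Set.Finite.mem_toFinset]
    constructor
    · rintro ⟨⟨j', x', y'⟩, ht, h⟩
      obtain ⟨hj, h'⟩ := pair_injective h
      obtain ⟨hx, hy⟩ := pair_injective h'
      simpa [← hj, ← hx, ← hy] using ht
    · exact fun h => ⟨_, h, rfl⟩
  rw [← hmem, List.mem_iff_getElem]
  simp only [Mem, fst_pair, snd_pair]
  constructor
  · rintro ⟨i, hi, hb⟩
    -- The coded length is standard, so no nonstandard index can contribute spurious members.
    obtain ⟨k, hk, rfl⟩ := exists_natCast_of_lt hi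
    exact ⟨k, hk, by rw [(huv k hk _).1 hb]; simp [hk]⟩
  · rintro ⟨i, hi, h⟩
    exact ⟨i, by exact_mod_cast hi, (huv i hi _).2 (by simp [hi, h])⟩

end Mem

/-! ### Back-and-forth games of nonstandard depth -/

section Game

variable {M : Type w} [CommSemiring M] [LinearOrder M]

/-- Some coded finite relation relates the values at `a` and `b` of all functions of depth less
than `N`, and preserves the order. -/
def AgreeUpTo (N a b : M) : Prop :=
  ∃ c, Mem c 0 a b ∧ Mem c 0 0 0 ∧ Mem c 0 1 1 ∧
    (∀ j x y x' y', j < N → Mem c j x y → Mem c j x' y' →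
      Mem c (j + 1) x y ∧ Mem c (j + 1) (x + x') (y + y') ∧ Mem c (j + 1) (x * x') (y * y') ∧
      Mem c (j + 1) (fst x) (fst y) ∧ Mem c (j + 1) (snd x) (snd y)) ∧
    ∀ j x y x' y', j < N → Mem c j x y → Mem c j x' y' → (x < x' ↔ y < y')

/-- The second player survives `k` rounds of the back-and-forth game from the position `(a, b)`,
when the final position is judged by `AgreeUpTo N`. -/
def Game : ℕ → M → M → M → Prop
  | 0, N, a, b => AgreeUpTo N a b
  | k + 1, N, a, b => (∀ c, ∃ d, Game k N (pair a c) (pair b d)) ∧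
      ∀ d, ∃ c, Game k N (pair a c) (pair b d)

variable [arith.Structure M] [IsStrictOrderedRing M] [CanonicallyOrderedAdd M]
  [ArithModel M]

/-- Because the finite relation is coded by an element, the depth is itself a first-order variable
and overspill can be applied to it. -/
theorem isDef_agreeUpTo : IsDef fun v : Fin 3 → M => AgreeUpTo (v 0) (v 1) (v 2) := by
  refine .ex (.and (isDef_mem (.var _) .zero (.var _) (.var _)) (.and
    (isDef_mem (.var _) .zero .zero .zero) (.and (isDef_mem (.var _) .zero .one .one)
    (.and ?_ ?_))))
  · refine .all (.all (.all (.all (.all (.imp (.lt (.var _) (.var _)) (.imp ?_ (.imp ?_ ?_)))))))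
    · exact isDef_mem (.var _) (.var _) (.var _) (.var _)
    · exact isDef_mem (.var _) (.var _) (.var _) (.var _)
    · refine .and ?_ (.and ?_ (.and ?_ (.and ?_ ?_)))
      · exact isDef_mem (.var _) (.add (.var _) .one) (.var _) (.var _)
      · exact isDef_mem (.var _) (.add (.var _) .one) (.add (.var _) (.var _))
          (.add (.var _) (.var _))
      · exact isDef_mem (.var _) (.add (.var _) .one) (.mul (.var _) (.var _))
          (.mul (.var _) (.var _))
      · exact isDef_mem (.var _) (.add (.var _) .one) (.fst (.var _)) (.fst (.var _))
      · exact isDef_mem (.var _) (.add (.var _) .one) (.snd (.var _)) (.snd (.var _))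
  · refine .all (.all (.all (.all (.all (.imp (.lt (.var _) (.var _)) (.imp ?_ (.imp ?_ ?_)))))))
    · exact isDef_mem (.var _) (.var _) (.var _) (.var _)
    · exact isDef_mem (.var _) (.var _) (.var _) (.var _)
    · exact .iff (.lt (.var _) (.var _)) (.lt (.var _) (.var _))

theorem isDef_game (k : ℕ) : IsDef fun v : Fin 3 → M => Game k (v 0) (v 1) (v 2) := by
  induction k with
  | zero => exact isDef_agreeUpTo
  | succ k ih =>
    refine .and (.all (.ex ?_)) (.all (.ex ?_))
    · exact ih.subst₃ (.var _) (.pair (.var _) (.var _)) (.pair (.var _) (.var _))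
    · exact ih.subst₃ (.var _) (.pair (.var _) (.var _)) (.pair (.var _) (.var _))

theorem natCast_lt_of_nonstandard {N : M} (hN : ∀ k : ℕ, N ≠ k) (j : ℕ) : (j : M) < N := by
  by_contra! h
  obtain ⟨k, -, hk⟩ := exists_natCast_of_lt (x := N) (n := j + 1)
    (h.trans_lt (by exact_mod_cast j.lt_succ_self))
  exact hN k hk

/-- Every standard depth lies below `N`, so the closure conditions on the coded relation never run
out: external induction on the depth relates the values at `a` and `b` of every elementary function.
-/
theorem AgreeUpTo.lt_iff {N a b : M} (hN : ∀ k : ℕ, N ≠ k) (h : AgreeUpTo N a b) {f g : M → M}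
    (hf : IsElem f) (hg : IsElem g) : f a < g a ↔ f b < g b := by
  obtain ⟨c, hab, h0, h1, hstep, hlt⟩ := h
  have key : ∀ j : ℕ, ∀ f ∈ level j, Mem c j (f a) (f b) := by
    intro j
    induction j with
    | zero =>
      intro f hf
      rw [Nat.cast_zero]
      obtain rfl | rfl | rfl := hf
      exacts [hab, h0, h1]
    | succ j ih =>
      intro f hf
      rw [Nat.cast_succ]
      have hj := natCast_lt_of_nonstandard hN j
      rw [mem_level_succ] at hf
      rcases hf with hf | ⟨f, hf, g, hg, rfl⟩ | ⟨f, hf, g, hg, rfl⟩ |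
        ⟨f, hf, rfl⟩ | ⟨f, hf, rfl⟩
      · exact (hstep _ _ _ _ _ hj (ih f hf) (ih f hf)).1
      · exact (hstep _ _ _ _ _ hj (ih f hf) (ih g hg)).2.1
      · exact (hstep _ _ _ _ _ hj (ih f hf) (ih g hg)).2.2.1
      · exact (hstep _ _ _ _ _ hj (ih f hf) (ih f hf)).2.2.2.1
      · exact (hstep _ _ _ _ _ hj (ih f hf) (ih f hf)).2.2.2.2
  obtain ⟨j, hf, hg⟩ := hf.exists_common hg
  exact hlt _ _ _ _ _ (natCast_lt_of_nonstandard hN j) (key j f hf) (key j g hg)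

theorem Game.lt_iff {N : M} (hN : ∀ k : ℕ, N ≠ k) {k : ℕ} {a b : M} (h : Game k N a b)
    {f g : M → M} (hf : IsElem f) (hg : IsElem g) : f a < g a ↔ f b < g b := by
  induction k generalizing a b f g with
  | zero => exact AgreeUpTo.lt_iff hN h hf hg
  | succ k ih =>
    -- Any move would do: the old position survives as the first component of the new one.
    obtain ⟨d, hd⟩ := h.1 0
    simpa using ih hd (hf.comp IsElem.id.fst) (hg.comp IsElem.id.fst)

/-- The witness codes the finite set of triples `(j, f a, f b)` with `f` in `level j` and `j ≤ n`;
the closure conditions mirror the definition of `level`. -/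
theorem agreeUpTo_natCast {n : ℕ} {a b : M}
    (h : ∀ f ∈ level n, ∀ g ∈ level n, f a < g a ↔ f b < g b) : AgreeUpTo (n : M) a b := by
  obtain ⟨c, hc⟩ := exists_forall_mem_iff
    (F := ⋃ j ∈ Set.Iic n, (fun f : M → M => ((j : M), f a, f b)) '' level j)
    ((Set.finite_Iic n).biUnion fun j _ => (finite_level j).image _)
  have hc' : ∀ (j : ℕ) x y, Mem c j x y ↔ j ≤ n ∧ ∃ f ∈ level j, f a = x ∧ f b = y := by
    intro j x y
    rw [hc]
    simp only [Set.mem_iUnion, Set.mem_image, Set.mem_Iic, Prod.mk.injEq, Nat.cast_inj]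
    constructor
    · rintro ⟨i, hi, f, hf, rfl, rfl, rfl⟩
      exact ⟨hi, f, hf, rfl, rfl⟩
    · rintro ⟨hj, f, hf, rfl, rfl⟩
      exact ⟨j, hj, f, hf, rfl, rfl, rfl⟩
  refine ⟨c, ?_, ?_, ?_, ?_, ?_⟩
  · exact_mod_cast (hc' 0 a b).2 ⟨n.zero_le, fun x => x, by simp [level], rfl, rfl⟩
  · exact_mod_cast (hc' 0 0 0).2 ⟨n.zero_le, fun _ => 0, by simp [level], rfl, rfl⟩
  · exact_mod_cast (hc' 0 1 1).2 ⟨n.zero_le, fun _ => 1, by simp [level], rfl, rfl⟩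
  · intro j x y x' y' hj hxy hxy'
    obtain ⟨i, hi, rfl⟩ := exists_natCast_of_lt hj
    obtain ⟨-, f, hf, rfl, rfl⟩ := (hc' _ _ _).1 hxy
    obtain ⟨-, g, hg, rfl, rfl⟩ := (hc' _ _ _).1 hxy'
    rw [← Nat.cast_succ]
    simp only [hc']
    refine ⟨⟨hi, f, mem_level_succ.2 (.inl hf), rfl, rfl⟩,
      ⟨hi, _, mem_level_succ.2 (.inr (.inl ⟨f, hf, g, hg, rfl⟩)), rfl, rfl⟩,
      ⟨hi, _, mem_level_succ.2 (.inr (.inr (.inl ⟨f, hf, g, hg, rfl⟩))), rfl, rfl⟩,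
      ⟨hi, _, mem_level_succ.2 (.inr (.inr (.inr (.inl ⟨f, hf, rfl⟩)))), rfl, rfl⟩,
      ⟨hi, _, mem_level_succ.2 (.inr (.inr (.inr (.inr ⟨f, hf, rfl⟩)))), rfl, rfl⟩⟩
  · intro j x y x' y' hj hxy hxy'
    obtain ⟨i, hi, rfl⟩ := exists_natCast_of_lt hj
    obtain ⟨-, f, hf, rfl, rfl⟩ := (hc' _ _ _).1 hxy
    obtain ⟨-, g, hg, rfl, rfl⟩ := (hc' _ _ _).1 hxy'
    exact h f (level_mono hi.le hf) g (level_mono hi.le hg)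

/-- For standard `n` the game relation is coarser than a partition into finitely many definable
classes. -/
theorem exists_game_invariant (n k : ℕ) : ∃ (F : Type w) (_ : Finite F) (inv : M → F),
    (∀ t, IsDef fun v : Fin 1 → M => inv (v 0) = t) ∧
      ∀ a b, inv a = inv b → Game k (n : M) a b := by
  induction k with
  | zero =>
    have := (finite_level (M := M) n).to_subtype
    -- The invariant records the order pattern of the values of all functions of depth at most `n`.
    refine ⟨level (M := M) n → level (M := M) n → Prop, inferInstance,
      fun a f g => f.1 a < g.1 a, fun t => ?_, fun a b hab => ?_⟩
    · simp only [funext_iff, eq_iff_iff]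
      refine .forall_finite fun f => .forall_finite fun g => .iff (.lt ?_ ?_) (.const _)
      · exact IsElem.isDefFun ⟨n, f.2⟩ (.var _)
      · exact IsElem.isDefFun ⟨n, g.2⟩ (.var _)
    · exact agreeUpTo_natCast fun f hf g hg =>
        iff_of_eq (congrFun (congrFun hab ⟨f, hf⟩) ⟨g, hg⟩)
  | succ k ih =>
    obtain ⟨F, _, inv, hdef, hinv⟩ := ih
    -- The new invariant is the set of old invariants reachable in one move; equal sets let either
    -- side's move be answered.
    refine ⟨Set F, inferInstance, fun a => {t | ∃ c, inv (pair a c) = t}, fun s => ?_,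
      fun a b hab => ⟨fun c => ?_, fun d => ?_⟩⟩
    · simp only [Set.ext_iff]
      refine .forall_finite fun t => .iff (.ex ?_) (.const _)
      exact (hdef t).subst₁ (P := fun x => inv x = t) (.pair (.var _) (.var _))
    · obtain ⟨d, hd⟩ : inv (pair a c) ∈ {t | ∃ d, inv (pair b d) = t} :=
        (Set.ext_iff.1 hab _).1 ⟨c, rfl⟩
      exact ⟨d, hinv _ _ hd.symm⟩
    · obtain ⟨c, hc⟩ : inv (pair b d) ∈ {t | ∃ c, inv (pair a c) = t} :=
        (Set.ext_iff.1 hab _).2 ⟨d, rfl⟩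
      exact ⟨c, hinv _ _ hc⟩

/-- For each standard `n` the invariant class of `a` is definable, so it contains `b`, and the game
of depth `n` is survived. Overspill in the depth, with `k` fixed, does the rest. -/
theorem exists_nonstandard_game (hM : ∃ x : M, ∀ k : ℕ, x ≠ k) {a b : M}
    (hab : ∀ P : M → Prop, IsDef (fun v : Fin 1 → M => P (v 0)) → P a → P b) (k : ℕ) :
    ∃ N : M, (∀ k : ℕ, N ≠ k) ∧ Game k N a b := by
  refine overspill (isDef_game k) a b hM fun n => ?_
  obtain ⟨F, _, inv, hdef, hinv⟩ := exists_game_invariant (M := M) n k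
  exact hinv a b (hab (fun x => inv x = inv a) (hdef _) rfl).symm

end Game

end arith

-- Inversion of the ranks of infinitary formulas

namespace InfFormula

variable {L : FirstOrder.Language.{u, v}} {α : Ordinal.{0}} {n : ℕ} {k : ℕ → ℕ}
  {ψ : ∀ i, InfFormula L (n + k i)}

theorem isSigma_disjEx_iff : (disjEx k ψ).IsSigma α ↔
    ∃ β : ℕ → Ordinal.{0}, (∀ i, β i < α) ∧ ∀ i, (ψ i).IsPi (β i) := by
  refine ⟨fun h => ?_, fun ⟨β, hβ, hψ⟩ => .disjEx k ψ β hβ hψ⟩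
  cases h with
  | disjEx _ _ β hβ hψ => exact ⟨β, hβ, hψ⟩

theorem isPi_conjAll_iff : (conjAll k ψ).IsPi α ↔
    ∃ β : ℕ → Ordinal.{0}, (∀ i, β i < α) ∧ ∀ i, (ψ i).IsSigma (β i) := by
  refine ⟨fun h => ?_, fun ⟨β, hβ, hψ⟩ => .conjAll k ψ β hβ hψ⟩
  cases h with
  | conjAll _ _ β hβ hψ => exact ⟨β, hβ, hψ⟩

theorem not_isPi_disjEx : ¬ (disjEx k ψ).IsPi α := fun h => by cases h

theorem not_isSigma_conjAll : ¬ (conjAll k ψ).IsSigma α := fun h => by cases h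

theorem exists_isPi_of_isSigma_natCast {m : ℕ} (h : (disjEx k ψ).IsSigma (m : Ordinal.{0}))
    (i : ℕ) :
    ∃ m' < m, (ψ i).IsPi (m' : Ordinal.{0}) := by
  obtain ⟨β, hβ, hψ⟩ := isSigma_disjEx_iff.1 h
  obtain ⟨m', hm'⟩ := Ordinal.lt_omega0.1 ((hβ i).trans (Ordinal.natCast_lt_omega0 m))
  exact ⟨m', by exact_mod_cast hm' ▸ hβ i, hm' ▸ hψ i⟩

theorem exists_isSigma_of_isPi_natCast {m : ℕ} (h : (conjAll k ψ).IsPi (m : Ordinal.{0}))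
    (i : ℕ) :
    ∃ m' < m, (ψ i).IsSigma (m' : Ordinal.{0}) := by
  obtain ⟨β, hβ, hψ⟩ := isPi_conjAll_iff.1 h
  obtain ⟨m', hm'⟩ := Ordinal.lt_omega0.1 ((hβ i).trans (Ordinal.natCast_lt_omega0 m))
  exact ⟨m', by exact_mod_cast hm' ▸ hβ i, hm' ▸ hψ i⟩

end InfFormula

namespace arith

/-! ### Infinitary formulas of finite rank -/

section Infinitary

variable {M : Type w} [CommSemiring M]

/-- The extension of the tuple of functions `fs` by the entries of the second component. -/
noncomputable def extend {n : ℕ} (fs : Fin n → M → M) (l : ℕ) : Fin (n + l) → M → M :=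
  Fin.append (fun i x => fs i (fst x)) fun (i : Fin l) x => entry i (snd x)

theorem isElem_extend {n : ℕ} {fs : Fin n → M → M} (hfs : ∀ i, IsElem (fs i)) (l : ℕ)
    (i : Fin (n + l)) : IsElem (extend fs l i) := by
  refine Fin.addCases (fun i => ?_) (fun i => ?_) i
  · rw [extend, Fin.append_left]
    exact (hfs i).comp IsElem.id.fst
  · rw [extend, Fin.append_right]
    exact (isElem_entry i).comp IsElem.id.snd

variable [LinearOrder M] [arith.Structure M] [ArithModel M]

theorem exists_isElem_realize_term {β : Type} (t : arith.Term β) (fs : β → M → M)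
    (hfs : ∀ i, IsElem (fs i)) :
    ∃ f : M → M, IsElem f ∧ ∀ a, t.realize (fun i => fs i a) = f a := by
  induction t with
  | var i => exact ⟨fs i, hfs i, fun _ => rfl⟩
  | func F ts ih =>
    choose g hg hga using ih
    cases F with
    | zero =>
      refine ⟨_, .zero, fun a => ?_⟩
      rw [← ArithOps.zero_eq (M := M)]
      exact congrArg (Structure.funMap _) (Subsingleton.elim (α := Fin 0 → M) _ _)
    | one =>
      refine ⟨_, .one, fun a => ?_⟩
      rw [← ArithOps.one_eq (M := M)]
      exact congrArg (Structure.funMap _) (Subsingleton.elim (α := Fin 0 → M) _ _)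
    | add =>
      refine ⟨_, (hg 0).add (hg 1), fun a => ?_⟩
      rw [← hga, ← hga, ← ArithOps.add_eq (M := M)]
      refine congrArg (Structure.funMap _) (funext fun i => ?_)
      fin_cases i <;> rfl
    | mul =>
      refine ⟨_, (hg 0).mul (hg 1), fun a => ?_⟩
      rw [← hga, ← hga, ← ArithOps.mul_eq (M := M)]
      refine congrArg (Structure.funMap _) (funext fun i => ?_)
      fin_cases i <;> rfl

theorem realize_isQF_iff {a b : M}
    (h : ∀ f g : M → M, IsElem f → IsElem g → (f a < g a ↔ f b < g b)) {n : ℕ}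
    {φ : arith.Formula (Fin n)} (hφ : BoundedFormula.IsQF φ) (fs : Fin n → M → M)
    (hfs : ∀ i, IsElem (fs i)) :
    φ.Realize (fun i => fs i a) ↔ φ.Realize (fun i => fs i b) := by
  have hterm : ∀ t : arith.Term (Fin n ⊕ Fin 0), ∃ f : M → M, IsElem f ∧
      ∀ a, t.realize (Sum.elim (fun i => fs i a) default) = f a := fun t => by
    obtain ⟨f, hf, hfa⟩ := exists_isElem_realize_term t
      (Sum.elim fs fun i => i.elim0) (by rintro (i | i); exacts [hfs i, i.elim0])
    refine ⟨f, hf, fun a => (hfa a).symm ▸ congrArg (fun v => t.realize v) ?_⟩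
    ext (i | i)
    exacts [rfl, i.elim0]
  unfold Formula.Realize
  induction hφ with
  | falsum => exact Iff.rfl
  | imp _ _ ih₁ ih₂ => exact imp_congr ih₁ ih₂
  | of_isAtomic hφ =>
    cases hφ with
    | equal s t =>
      obtain ⟨f, hf, hfa⟩ := hterm s
      obtain ⟨g, hg, hga⟩ := hterm t
      simp only [BoundedFormula.realize_bdEqual, hfa, hga]
      -- In a linear order, equality is the failure of both strict inequalities, so agreement on `<`
      -- is enough.
      simp only [le_antisymm_iff, ← not_lt, h f g hf hg, h g f hg hf]
    | rel R ts =>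
      cases R
      obtain ⟨f, hf, hfa⟩ := hterm (ts 0)
      obtain ⟨g, hg, hga⟩ := hterm (ts 1)
      have key : ∀ a, (Relations.boundedFormula (L := arith) ArithRel.lt ts).Realize
          (fun i => fs i a) default ↔ f a < g a := fun a => by
        rw [← hfa, ← hga, ← ArithOps.lt_iff (M := M)]
        refine BoundedFormula.realize_rel.trans (iff_of_eq (congrArg _ (funext fun i => ?_)))
        fin_cases i <;> rfl
      exact (key a).trans ((h f g hf hg).trans (key b).symm)

/-- A model of arithmetic all of whose elements are standard is homogeneous. -/
theorem isHomogeneous_of_standard (hM : ∀ x : M, ∃ k : ℕ, x = k) : IsHomogeneous arith M := by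
  intro s f _ hf
  -- Each element is the value of a numeral and hence definable, so an elementary map can only fix
  -- it.
  refine ⟨Language.Equiv.refl arith M, fun x => ?_⟩
  obtain ⟨k, hk⟩ := hM x
  obtain ⟨φ, hφ⟩ := IsDef.eq (M := M) (.var (0 : Fin 1)) (.natCast k)
  have hfx := (hf (φ.relabel fun _ => x)).1 (by simpa [hφ] using hk)
  rw [Formula.realize_relabel, hφ] at hfx
  exact hk.trans hfx.symm

variable [IsStrictOrderedRing M] [CanonicallyOrderedAdd M]

theorem extend_pair {n : ℕ} (fs : Fin n → M → M) (l : ℕ) (a c : M) :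
    (fun i => extend fs l i (pair a c)) =
      Fin.append (fun i => fs i a) fun i : Fin l => entry i c := by
  ext i
  refine Fin.addCases (fun i => ?_) (fun i => ?_) i <;> simp [extend]

theorem extend_pair_encode {n : ℕ} (fs : Fin n → M → M) {l : ℕ} (a : M) (c : Fin l → M) :
    (fun i => extend fs l i (pair a (encode c))) = Fin.append (fun i => fs i a) c := by
  simp [extend_pair]

/-- Positions from which the second player survives `k` rounds of the game of nonstandard depth
satisfy the same infinitary formulas of rank at most `k`. -/
theorem Game.realize_iff {N : M} (hN : ∀ k : ℕ, N ≠ k) {k : ℕ} {a b : M} (h : Game k N a b)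
    {n : ℕ} (φ : InfFormula arith n) {m : ℕ} (hm : m ≤ k)
    (hφ : φ.IsSigma (m : Ordinal.{0}) ∨ φ.IsPi (m : Ordinal.{0})) (fs : Fin n → M → M)
    (hfs : ∀ i, IsElem (fs i)) :
    φ.Realize (fun i => fs i a) ↔ φ.Realize (fun i => fs i b) := by
  induction k generalizing a b n m with
  | zero =>
    cases φ with
    | qf φ hqf => exact realize_isQF_iff (fun f g hf hg => h.lt_iff hN hf hg) hqf fs hfs
    | disjEx l ψ =>
      -- The index set is nonempty, so the disjunct of index 0 would have a rank below 0.
      obtain ⟨m', hlt, -⟩ := InfFormula.exists_isPi_of_isSigma_natCast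
        (hφ.resolve_right InfFormula.not_isPi_disjEx) 0
      omega
    | conjAll l ψ =>
      obtain ⟨m', hlt, -⟩ := InfFormula.exists_isSigma_of_isPi_natCast
        (hφ.resolve_left InfFormula.not_isSigma_conjAll) 0
      omega
  | succ k ih =>
    cases φ with
    | qf φ hqf => exact realize_isQF_iff (fun f g hf hg => h.lt_iff hN hf hg) hqf fs hfs
    | disjEx l ψ =>
      simp only [InfFormula.Realize]
      refine exists_congr fun i => ?_
      obtain ⟨m', hlt, hψi⟩ := InfFormula.exists_isPi_of_isSigma_natCast
        (hφ.resolve_right InfFormula.not_isPi_disjEx) i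
      constructor
      · rintro ⟨c, hc⟩
        obtain ⟨d, hd⟩ := h.1 (encode c)
        -- The answer `d` need not be the code of a tuple; `entry` is total, and its values are the
        -- required witnesses.
        refine ⟨fun j => entry j d, ?_⟩
        rw [← extend_pair]
        rw [← extend_pair_encode] at hc
        exact (ih hd (ψ i) (by omega) (.inr hψi) _ (isElem_extend hfs _)).1 hc
      · rintro ⟨d, hd⟩
        obtain ⟨c, hc⟩ := h.2 (encode d)
        refine ⟨fun j => entry j c, ?_⟩
        rw [← extend_pair]
        rw [← extend_pair_encode] at hd
        exact (ih hc (ψ i) (by omega) (.inr hψi) _ (isElem_extend hfs _)).2 hd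
    | conjAll l ψ =>
      simp only [InfFormula.Realize]
      refine forall_congr' fun i => ?_
      obtain ⟨m', hlt, hψi⟩ := InfFormula.exists_isSigma_of_isPi_natCast
        (hφ.resolve_left InfFormula.not_isSigma_conjAll) i
      constructor
      · intro hall d
        obtain ⟨c, hc⟩ := h.2 (encode d)
        rw [← extend_pair_encode]
        refine (ih hc (ψ i) (by omega) (.inl hψi) _ (isElem_extend hfs _)).1 ?_
        rw [extend_pair]
        exact hall _
      · intro hall c
        obtain ⟨d, hd⟩ := h.1 (encode c)
        rw [← extend_pair_encode]
        refine (ih hd (ψ i) (by omega) (.inl hψi) _ (isElem_extend hfs _)).2 ?_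
        rw [extend_pair]
        exact hall _

/-- In a nonstandard model, tuples of the same complete type satisfy the same infinitary formulas
of rank at most `ω`. -/
theorem realize_of_isSigma_of_le_omega0 (hM : ∃ x : M, ∀ k : ℕ, x ≠ k) {n : ℕ} {a b : Fin n → M}
    (hab : ∀ φ : arith.Formula (Fin n), φ.Realize a → φ.Realize b) {α : Ordinal.{0}}
    (hα : α ≤ Ordinal.omega0) {φ : InfFormula arith n} (hφ : φ.IsSigma α) (ha : φ.Realize a) :
    φ.Realize b := by
  cases hφ with
  | qf φ hqf => exact hab φ ha
  | disjEx l ψ β hβ hψ =>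
    obtain ⟨i, c, hc⟩ := ha
    obtain ⟨m, hm⟩ := Ordinal.lt_omega0.1 ((hβ i).trans_le hα)
    have hψi := hψ i
    rw [hm] at hψi
    -- One round answers the outer existential block and `m` rounds remain for the disjunct of rank
    -- `m`. The depth `N` may depend on `m`, since a single disjunct is transferred.
    obtain ⟨N, hN, hgame⟩ := exists_nonstandard_game hM (a := encode a) (b := encode b)
      (fun P hP hPa => by
        obtain ⟨χ, hχ⟩ := hP.subst₁ (P := P) (isDefFun_encode (fun i : Fin n => i))
        exact (hχ b).1 (hab χ ((hχ a).2 hPa))) (m + 1)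
    obtain ⟨d, hd⟩ := hgame.1 (encode c)
    refine ⟨i, fun j => entry j d, ?_⟩
    have key := (hd.realize_iff hN (ψ i) le_rfl (.inr hψi)
      (extend (fun (i : Fin n) x => entry i x) (l i))
      (isElem_extend (fun i => isElem_entry i) _)).1
    rw [extend_pair_encode, extend_pair] at key
    simpa using key (by simpa using hc)

end Infinitary

end arith

theorem mainTheorem7 (M : Type*) [arith.Structure M] [Countable M] (hPA : M ⊨ arith.PA)
    (hM : ¬ IsHomogeneous arith M) :
    ((Ordinal.omega0 : Ordinal.{0}) : WithTop Ordinal.{0}) < scottRank arith M := by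
  obtain ⟨_, _, _, _, _⟩ := arith.exists_orderedSemiring_of_PA hPA
  by_contra hle
  rw [not_lt] at hle
  obtain ⟨α, hα, hαω⟩ : ∃ α : Ordinal.{0}, OrbitsSigmaDefinable arith M α ∧
      α ≤ Ordinal.omega0 := by
    rw [scottRank] at hle
    -- An empty set would have infimum `⊤`, which is not at most `ω`; a nonempty one attains its
    -- infimum.
    have hne : ((fun α : Ordinal.{0} => (α : WithTop Ordinal.{0})) ''
        {α | OrbitsSigmaDefinable arith M α}).Nonempty := by
      by_contra hne
      rw [Set.not_nonempty_iff_eq_empty.1 hne, WithTop.sInf_empty] at hle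
      exact WithTop.coe_ne_top (top_le_iff.1 hle)
    obtain ⟨α, hα, hαeq⟩ := csInf_mem hne
    rw [← hαeq] at hle
    exact ⟨α, hα, WithTop.coe_le_coe.1 hle⟩
  by_cases hst : ∀ x : M, ∃ k : ℕ, x = k
  · exact hM (arith.isHomogeneous_of_standard hst)
  push Not at hst
  refine hM fun s f hs hf => ?_
  have := hs.to_subtype
  obtain ⟨n, ⟨e⟩⟩ := Finite.exists_equiv_fin s
  obtain ⟨φ, hφ, horbit⟩ := hα n fun i => (e.symm i : M)
  -- The orbit formula holds at the enumerated domain of `f` by the identity automorphism, and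
  -- transfers to the image because `f` preserves types.
  obtain ⟨σ, hσ⟩ := (horbit fun i => f (e.symm i)).1 <|
    arith.realize_of_isSigma_of_le_omega0 hst
      (fun χ hχ => by
        have := (hf (χ.relabel e.symm)).1 (by rwa [Formula.realize_relabel])
        rwa [Formula.realize_relabel] at this)
      hαω hφ ((horbit _).2 ⟨Language.Equiv.refl arith M, fun _ => rfl⟩)
  exact ⟨σ, fun x => by simpa using hσ (e x)⟩
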